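/- Let $(M,d\lambda)$ be a connected exact symplectic manifold with $H^1(M;\mathbb R)=0$, and let $\mathrm{Symp}(M,d\lambda)$ be its group of symplectic diffeomorphisms, regarded as a discrete group. For a reference point $x\in M$ let $\mathfrak G=\mathfrak G_{x,\lambda}$ be the real two-cocycle on this group given by $$\mathfrak G_{x,\lambda}(g,h)=\int_x^{h(x)} (g^*\lambda-\lambda),$$ where the integral is taken along any smooth curve from $x$ to $h(x)$. A foliated symplectic bundle $(M,d\lambda)\to E\to B$ is a bundle with fibre $M$ and a foliation transverse to the fibres with holonomy in $\mathrm{Symp}(M,d\lambda)$, i.e. a bundle with an atlas of local trivialisations whose changes of coordinates are locally constant in the base with values in $\mathrm{Symp}(M,d\lambda)$. Its characteristic class $\mathfrak G(E)\in H^2(B;\mathbb R)$ is the pullback of $[\mathfrak G]$ under the holonomy of the foliation: it is represented by the singular cocycle whose value on a singular simplex with vertices $b_0,b_1,b_2$ is $\mathfrak G(g,h)$, where $g$ and $h$ are the holonomies along the edges $b_0b_1$ and $b_1b_2$, expressed through chosen symplectic identifications of the fibres with $M$, with $gh$ the holonomy along $b_0b_2$. Let $i\colon L\to M$ be the inclusion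 of a connected (embedded) submanifold that is exact isotropic, i.e. the one-form $i^*\lambda$ is exact. Suppose that $E$ admits a foliated subbundle $L\to E'\to B$, i.e. a subset $E'\subset E$ that is a union of leaves of the foliation and such that near every point of $B$ some local trivialisation of the symplectic bundle $E$ over an open set $U$ identifies the pair $(E,E')$ with $(U\times M,U\times L)$. Then $\mathfrak G(E)=0$ in $H^2(B;\mathbb R)$. -/

import Mathlib

open Set Filter
open scoped Topology Manifold ContDiff

/-! ### Differential one-forms on a smooth manifold modelled on a normed space `V` -/

section Forms

variable {V : Type*} [NormedAddCommGroup V] [NormedSpace ℝ V]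
  {M : Type*} [TopologicalSpace M] [ChartedSpace V M]
  {W : Type*} [NormedAddCommGroup W] [NormedSpace ℝ W]
  {N : Type*} [TopologicalSpace N] [ChartedSpace W N]

variable (V M) in
/-- A (not necessarily smooth) differential one-form: a covector at every point. -/
abbrev OneForm : Type _ := (x : M) → TangentSpace 𝓘(ℝ, V) x →L[ℝ] ℝ

namespace OneForm

/-- The expression of a one-form in the preferred chart at `x₀`, as a covector-valued
function on the model space. It is meaningful on the target of the chart. -/
noncomputable def inChart (θ : OneForm V M) (x₀ : M) (y : V) : V →L[ℝ] ℝ :=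
  (θ ((extChartAt 𝓘(ℝ, V) x₀).symm y)).comp
    (mfderiv 𝓘(ℝ, V) 𝓘(ℝ, V) (extChartAt 𝓘(ℝ, V) x₀).symm y)

/-- Smoothness of a one-form: its coefficients are smooth in all preferred charts. -/
def IsSmooth (θ : OneForm V M) : Prop :=
  ∀ x₀ : M, ContDiffOn ℝ ∞ (θ.inChart x₀) (extChartAt 𝓘(ℝ, V) x₀).target

/-- The exterior derivative of a one-form at the point `x`, computed in the preferred chart
at `x`: `dθ(v, w) = ∂_v (θ(w)) - ∂_w (θ(v))`. (The tangent space at `x` is identified with `V`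
through the preferred chart at `x`.) -/
noncomputable def extD (θ : OneForm V M) (x : M) (v w : TangentSpace 𝓘(ℝ, V) x) : ℝ :=
  fderiv ℝ (θ.inChart x) (extChartAt 𝓘(ℝ, V) x x) v w -
    fderiv ℝ (θ.inChart x) (extChartAt 𝓘(ℝ, V) x x) w v

/-- A closed one-form: smooth with vanishing exterior derivative. -/
def IsClosed (θ : OneForm V M) : Prop :=
  θ.IsSmooth ∧ ∀ (x : M) (v w : TangentSpace 𝓘(ℝ, V) x), θ.extD x v w = 0

/-- An exact one-form: the differential of a smooth function. -/
def IsExact (θ : OneForm V M) : Prop :=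
  ∃ f : M → ℝ, ContMDiff 𝓘(ℝ, V) 𝓘(ℝ, ℝ) ∞ f ∧
    ∀ (x : M) (v : TangentSpace 𝓘(ℝ, V) x), θ x v = mfderiv 𝓘(ℝ, V) 𝓘(ℝ, ℝ) f x v

/-- The pullback `f^*θ` of a one-form. -/
noncomputable def pullback (f : N → M) (θ : OneForm V M) : OneForm W N :=
  fun x => (θ (f x)).comp (mfderiv 𝓘(ℝ, W) 𝓘(ℝ, V) f x)

/-- The integral of a one-form along the restriction of a curve `γ : ℝ → M` to `[0, 1]`. -/
noncomputable def lineIntegral (θ : OneForm V M) (γ : ℝ → M) : ℝ :=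
  ∫ t in (0 : ℝ)..1, θ (γ t) (mfderiv 𝓘(ℝ, ℝ) 𝓘(ℝ, V) γ t (1 : ℝ))

end OneForm

variable (V M) in
/-- The vanishing of the first real (de Rham) cohomology of `M`. -/
def FirstDeRhamVanishes : Prop := ∀ θ : OneForm V M, θ.IsClosed → θ.IsExact

/-- `(M, dλ)` is an exact symplectic manifold: `λ` is smooth and `dλ` is nondegenerate. -/
structure IsExactSymplectic (lam : OneForm V M) : Prop where
  smooth : lam.IsSmooth
  nondegenerate : ∀ (x : M) (v : TangentSpace 𝓘(ℝ, V) x),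
    (∀ w : TangentSpace 𝓘(ℝ, V) x, lam.extD x v w = 0) → v = 0

/-- The group `Symp(M, dλ)` of diffeomorphisms `g` of `M` such that `g^*(dλ) = dλ`;
the product of `g` and `h` is the composition `g ∘ h`. -/
def Symp (lam : OneForm V M) : Subgroup (Equiv.Perm M) where
  carrier := {g | ContMDiff 𝓘(ℝ, V) 𝓘(ℝ, V) ∞ g ∧ ContMDiff 𝓘(ℝ, V) 𝓘(ℝ, V) ∞ g.symm ∧
    ∀ (x : M) (v w : TangentSpace 𝓘(ℝ, V) x),
      lam.extD (g x) (mfderiv 𝓘(ℝ, V) 𝓘(ℝ, V) g x v) (mfderiv 𝓘(ℝ, V) 𝓘(ℝ, V) g x w) =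
        lam.extD x v w}
  mul_mem' := by
    rintro g h ⟨hg, hg', hgl⟩ ⟨hh, hh', hhl⟩
    refine ⟨hg.comp hh, hh'.comp hg', fun x v w => ?_⟩
    have hc : mfderiv 𝓘(ℝ, V) 𝓘(ℝ, V) (⇑(g * h)) x =
        (mfderiv 𝓘(ℝ, V) 𝓘(ℝ, V) g (h x)).comp (mfderiv 𝓘(ℝ, V) 𝓘(ℝ, V) h x) :=
      mfderiv_comp x (hg.mdifferentiable (by simp) (h x)) (hh.mdifferentiable (by simp) x)
    rw [hc]
    exact (hgl (h x) _ _).trans (hhl x v w)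
  one_mem' := by
    refine ⟨contMDiff_id, contMDiff_id, fun x v w => ?_⟩
    have hc : mfderiv 𝓘(ℝ, V) 𝓘(ℝ, V) (⇑(1 : Equiv.Perm M)) x =
        ContinuousLinearMap.id ℝ (TangentSpace 𝓘(ℝ, V) x) := mfderiv_id
    rw [hc]
    rfl
  inv_mem' := by
    rintro g ⟨hg, hg', hgl⟩
    refine ⟨hg', hg, fun x v w => ?_⟩
    obtain ⟨y, rfl⟩ := g.surjective x
    have hy : (g⁻¹ : Equiv.Perm M) (g y) = y := g.symm_apply_apply y
    have hc : (mfderiv 𝓘(ℝ, V) 𝓘(ℝ, V) g (g.symm (g y))).comp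
        (mfderiv 𝓘(ℝ, V) 𝓘(ℝ, V) g.symm (g y)) =
        ContinuousLinearMap.id ℝ (TangentSpace 𝓘(ℝ, V) (g y)) := by
      rw [← mfderiv_comp (g y) (hg.mdifferentiable (by simp) _)
        (hg'.mdifferentiable (by simp) _)]
      have : (g ∘ g.symm : M → M) = id := by ext z; simp
      rw [this]
      exact mfderiv_id
    have hv : ∀ u : TangentSpace 𝓘(ℝ, V) (g y), mfderiv 𝓘(ℝ, V) 𝓘(ℝ, V) g (g.symm (g y))
        (mfderiv 𝓘(ℝ, V) 𝓘(ℝ, V) g.symm (g y) u) = u := fun u =>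
      congrArg (fun A : V →L[ℝ] V => A u) hc
    have key := hgl (g.symm (g y)) (mfderiv 𝓘(ℝ, V) 𝓘(ℝ, V) g.symm (g y) v)
      (mfderiv 𝓘(ℝ, V) 𝓘(ℝ, V) g.symm (g y) w)
    rw [hv v, hv w] at key
    refine key.symm.trans ?_
    have hp : g (g.symm (g y)) = g y := g.apply_symm_apply (g y)
    have : ∀ z, z = g y → ∀ a b : V, lam.extD z a b = lam.extD (g y) a b := by
      rintro z rfl a b; rfl
    exact this _ hp v w

/-- In a connected manifold any two points are joined by a smooth curve. -/
theorem exists_smooth_curve [IsManifold 𝓘(ℝ, V) ∞ M] [ConnectedSpace M] (x y : M) :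
    ∃ γ : ℝ → M, ContMDiff 𝓘(ℝ, ℝ) 𝓘(ℝ, V) ∞ γ ∧ γ 0 = x ∧ γ 1 = y := by
  let R : M → M → Prop := fun x y => ∃ γ : ℝ → M, ContMDiff 𝓘(ℝ, ℝ) 𝓘(ℝ, V) ∞ γ ∧
    (∀ t ≤ 0, γ t = x) ∧ (∀ t, 1 ≤ t → γ t = y)
  have hsymm : ∀ x y, R x y → R y x := by
    rintro x y ⟨γ, hγ, h0, h1⟩
    refine ⟨fun t => γ (1 - t), hγ.comp ?_, fun t ht => h1 _ (by linarith),
      fun t ht => h0 _ (by linarith)⟩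
    exact (contDiff_const.sub contDiff_id).contMDiff
  have htrans : ∀ x y z, R x y → R y z → R x z := by
    rintro x y z ⟨γ, hγ, h0, h1⟩ ⟨δ, hδ, k0, k1⟩
    have hγ' : ContMDiff 𝓘(ℝ, ℝ) 𝓘(ℝ, V) ∞ (fun s : ℝ => γ (3 * s)) :=
      hγ.comp (contDiff_const.mul contDiff_id).contMDiff
    have hδ' : ContMDiff 𝓘(ℝ, ℝ) 𝓘(ℝ, V) ∞ (fun s : ℝ => δ (3 * s - 2)) :=
      hδ.comp ((contDiff_const.mul contDiff_id).sub contDiff_const).contMDiff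
    refine ⟨fun s => if s ≤ 1 / 2 then γ (3 * s) else δ (3 * s - 2), fun s => ?_,
      fun t ht => ?_, fun t ht => ?_⟩
    · rcases lt_or_ge s (2 / 3) with hs | hs
      · refine (hγ' s).congr_of_eventuallyEq ?_
        filter_upwards [Iio_mem_nhds hs] with u hu
        have hu' : u < 2 / 3 := hu
        split_ifs with h
        · rfl
        · rw [k0 _ (by linarith), h1 _ (by linarith)]
      · refine (hδ' s).congr_of_eventuallyEq ?_
        filter_upwards [Ioi_mem_nhds (show (1 / 3 : ℝ) < s by linarith)] with u hu
        have hu' : 1 / 3 < u := hu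
        split_ifs with h
        · rw [k0 _ (by linarith), h1 _ (by linarith)]
        · rfl
    · dsimp only
      rw [if_pos (by linarith), h0 _ (by linarith)]
    · dsimp only
      rw [if_neg (by linarith), k1 _ (by linarith)]
  have hloc : ∀ x, ∀ᶠ y in 𝓝 x, R x y := by
    intro x
    set φ := extChartAt 𝓘(ℝ, V) x with hφ
    have hT : φ.target ∈ 𝓝 (φ x) := extChartAt_target_mem_nhds x
    obtain ⟨r, hr, hb⟩ := Metric.mem_nhds_iff.1 hT
    have hcont : ContinuousAt φ x := continuousAt_extChartAt x
    filter_upwards [hcont.preimage_mem_nhds (Metric.ball_mem_nhds _ hr),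
      extChartAt_source_mem_nhds (I := 𝓘(ℝ, V)) x] with y hy hys
    have hmem : ∀ t : ℝ, φ x + Real.smoothTransition t • (φ y - φ x) ∈ φ.target := by
      intro t
      apply hb
      have := (convex_ball (φ x) r).add_smul_sub_mem (Metric.mem_ball_self hr) hy
        ⟨Real.smoothTransition.nonneg t, Real.smoothTransition.le_one t⟩
      exact this
    refine ⟨fun t => φ.symm (φ x + Real.smoothTransition t • (φ y - φ x)), ?_, ?_, ?_⟩
    · rw [← contMDiffOn_univ]
      refine (contMDiffOn_extChartAt_symm (I := 𝓘(ℝ, V)) (n := ∞) x).comp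
        (t := φ.target) ?_ (fun t _ => hmem t)
      refine ContDiff.contMDiff ?_ |>.contMDiffOn
      exact contDiff_const.add
        ((Real.smoothTransition.contDiff (n := ⊤)).smul contDiff_const)
    · intro t ht
      dsimp only
      rw [Real.smoothTransition.zero_of_nonpos ht, zero_smul, add_zero]
      exact extChartAt_to_inv x
    · intro t ht
      dsimp only
      rw [Real.smoothTransition.one_of_one_le ht, one_smul, add_sub_cancel]
      exact φ.left_inv hys
  have hclopen : IsClopen {y | R x y} := by
    constructor
    · rw [← isOpen_compl_iff, isOpen_iff_mem_nhds]
      intro y hy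
      filter_upwards [hloc y] with z hz hxz
      exact hy (htrans _ _ _ hxz (hsymm _ _ hz))
    · rw [isOpen_iff_mem_nhds]
      intro y hy
      filter_upwards [hloc y] with z hz
      exact htrans _ _ _ hy hz
  have huniv := hclopen.eq_univ ⟨x, (hloc x).self_of_nhds⟩
  have hxy : y ∈ {y | R x y} := by rw [huniv]; trivial
  obtain ⟨γ, hγ, h0, h1⟩ := hxy
  exact ⟨γ, hγ, h0 0 le_rfl, h1 1 le_rfl⟩

/-- The integral `∫_x^y θ` of a one-form along a smooth curve from `x` to `y`. It is used for
closed forms on a manifold with vanishing first cohomology, where it does not depend on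
the curve. -/
noncomputable def OneForm.integralBetween [IsManifold 𝓘(ℝ, V) ∞ M] [ConnectedSpace M]
    (θ : OneForm V M) (x y : M) : ℝ :=
  θ.lineIntegral (exists_smooth_curve (V := V) x y).choose

/-- The two-cocycle `𝔊_{x,λ}(g, h) = ∫_x^{h(x)} (g^*λ - λ)` on `Symp(M, dλ)`. -/
noncomputable def sympCocycle [IsManifold 𝓘(ℝ, V) ∞ M] [ConnectedSpace M]
    (lam : OneForm V M) (x : M) (g h : Symp lam) : ℝ :=
  OneForm.integralBetween (V := V) (lam.pullback (g : Equiv.Perm M) - lam) x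
    ((h : Equiv.Perm M) x)

end Forms

/-! ### Singular cohomology with real coefficients -/

section Singular

/-- The affine map of standard simplices induced by a map of the sets of vertices. -/
noncomputable def simplexMap {m n : ℕ} (f : Fin m → Fin n) :
    C(stdSimplex ℝ (Fin m), stdSimplex ℝ (Fin n)) :=
  ⟨stdSimplex.map f, stdSimplex.continuous_map f⟩

/-- Real-valued singular `n`-cochains of a topological space `B`: functions on the set of
continuous maps from the standard `n`-simplex to `B`. -/
abbrev SingularCochain (B : Type*) [TopologicalSpace B] (n : ℕ) : Type _ :=
  C(stdSimplex ℝ (Fin (n + 1)), B) → ℝ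

/-- The singular coboundary, `(δc)(τ) = ∑ᵢ (-1)ⁱ c(τ ∘ dⁱ)` with `dⁱ` the `i`-th face. -/
noncomputable def singularCoboundary (B : Type*) [TopologicalSpace B] (n : ℕ) :
    SingularCochain B n →ₗ[ℝ] SingularCochain B (n + 1) where
  toFun c τ := ∑ i : Fin (n + 2), (-1 : ℝ) ^ (i : ℕ) * c (τ.comp (simplexMap i.succAbove))
  map_add' c c' := by
    ext τ
    simp [mul_add, Finset.sum_add_distrib]
  map_smul' r c := by
    ext τ
    simp only [Pi.smul_apply, smul_eq_mul, RingHom.id_apply, Finset.mul_sum]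
    exact Finset.sum_congr rfl fun i _ => by ring

/-- Singular two-cocycles. -/
noncomputable abbrev SingularZ2 (B : Type*) [TopologicalSpace B] :
    Submodule ℝ (SingularCochain B 2) :=
  LinearMap.ker (singularCoboundary B 2)

/-- The singular cohomology `H²(B; ℝ)`: cocycles modulo coboundaries. -/
abbrev SingularH2 (B : Type*) [TopologicalSpace B] : Type _ :=
  SingularZ2 B ⧸ (LinearMap.range (singularCoboundary B 1)).submoduleOf (SingularZ2 B)

/-- The edge from vertex `i` to vertex `j` of a singular two-simplex, as a path. -/
noncomputable def singularEdge {B : Type*} [TopologicalSpace B]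
    (τ : C(stdSimplex ℝ (Fin 3), B)) (i j : Fin 3) : C(unitInterval, B) :=
  (τ.comp (simplexMap ![i, j])).comp
    ⟨stdSimplexHomeomorphUnitInterval.symm, stdSimplexHomeomorphUnitInterval.symm.continuous⟩

end Singular

/-! ### Foliated symplectic bundles -/

section Bundles

variable {V : Type*} [NormedAddCommGroup V] [NormedSpace ℝ V]
  {M : Type*} [TopologicalSpace M] [ChartedSpace V M]

/-- A foliated symplectic bundle `(M, dλ) → E → B`: a fibre bundle together with an atlas of local
trivializations `E|_U ≅ U × M` covering the base whose changes of coordinates are locally constant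
in the base with values in `Symp(M, dλ)`. The plaques `U' × {m}` (for small open `U'`) are matched
by the changes of coordinates; they are the plaques of the foliation of `E`, which
is transverse to the fibres and has holonomy in `Symp(M, dλ)`. -/
structure FoliatedSymplecticBundle (lam : OneForm V M) (B E : Type*)
    [TopologicalSpace B] [TopologicalSpace E] where
  /-- The bundle projection. -/
  proj : E → B
  /-- The foliated charts. -/
  atlas : Set (Bundle.Trivialization M proj)
  exists_mem_baseSet : ∀ b : B, ∃ e ∈ atlas, b ∈ e.baseSet
  locallyConstant : ∀ e ∈ atlas, ∀ e' ∈ atlas, ∀ b ∈ e.baseSet ∩ e'.baseSet,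
    ∃ g : Symp lam, ∀ᶠ b' in 𝓝 b, ∀ z : E, proj z = b' →
      (e' z).2 = (g : Equiv.Perm M) (e z).2

namespace FoliatedSymplecticBundle

variable {lam : OneForm V M} {B E : Type*} [TopologicalSpace B] [TopologicalSpace E]
  (F : FoliatedSymplecticBundle lam B E)

/-- A map into the total space is horizontal if it is continuous and its fibre coordinate is
locally constant in foliated charts, that is, if it locally runs inside a plaque. -/
def IsHorizontal {K : Type*} [TopologicalSpace K] (f : K → E) : Prop :=
  Continuous f ∧ ∀ k : K, ∃ e ∈ F.atlas, F.proj (f k) ∈ e.baseSet ∧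
    ∀ᶠ k' in 𝓝 k, (e (f k')).2 = (e (f k)).2

/-- The leaf of the foliation through `z`: all the points that can be reached from `z` by a
horizontal path. -/
def leaf (z : E) : Set E := {w | ∃ f : unitInterval → E, F.IsHorizontal f ∧ f 0 = z ∧ f 1 = w}

/-- A local trivialization of the underlying symplectic bundle (not necessarily compatible with
the foliation): on every fibre it differs from the foliated charts by an element of
`Symp(M, dλ)`. -/
def IsSymplecticTrivialization (t : Bundle.Trivialization M F.proj) : Prop :=
  ∀ b ∈ t.baseSet, ∀ e ∈ F.atlas, b ∈ e.baseSet →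
    ∃ g : Symp lam, ∀ z : E, F.proj z = b → (e z).2 = (g : Equiv.Perm M) (t z).2

/-- `E' ⊆ E` is a foliated subbundle with fibre `L ⊆ M`: near every point of the base there is a
trivialization of the symplectic bundle `E` that identifies the pair `(E, E')` with
`(U × M, U × L)`, and `E'` is a union of leaves of the foliation of `E`. -/
structure IsFoliatedSubbundle (L : Set M) (E' : Set E) : Prop where
  locallyTrivial : ∀ b : B, ∃ t : Bundle.Trivialization M F.proj,
    F.IsSymplecticTrivialization t ∧ b ∈ t.baseSet ∧
      ∀ z : E, F.proj z ∈ t.baseSet → (z ∈ E' ↔ (t z).2 ∈ L)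
  leaf_subset : ∀ z ∈ E', F.leaf z ⊆ E'

/-- A symplectic identification of `M` with the fibre of `E` over `b`. -/
structure Frame (b : B) where
  /-- The identification. -/
  toFun : M → E
  proj_toFun : ∀ m : M, F.proj (toFun m) = b
  symplectic : ∀ e ∈ F.atlas, b ∈ e.baseSet →
    ∃ g : Symp lam, ∀ m : M, (e (toFun m)).2 = (g : Equiv.Perm M) m

/-- The fibre coordinate of a point, moved back by the inverse of a chart. -/
theorem eq_symm_of_snd (e : Bundle.Trivialization M F.proj) {z : E} {b : B} {m : M}
    (hz : F.proj z = b) (hb : b ∈ e.baseSet) (hm : (e z).2 = m) :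
    z = e.toOpenPartialHomeomorph.symm (b, m) := by
  have hs : z ∈ e.source := e.mem_source.2 (by rw [hz]; exact hb)
  have h1 : e z = (b, m) := by
    rw [← e.mk_proj_snd hs, hz, hm]
  have h2 := e.toOpenPartialHomeomorph.left_inv hs
  rw [← h2]
  exact congrArg _ h1

/-- Parallel transport along a path exists: relative to symplectic identifications `p`, `q` of `M`
with the fibres over the endpoints it is given by a (unique) element `g` of `Symp(M, dλ)`, such
that `p (g m)` and `q m` are joined by a horizontal lift of the path for all `m`. -/
theorem exists_holonomy (γ : C(unitInterval, B)) (p : F.Frame (γ 0)) (q : F.Frame (γ 1)) :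
    ∃ g : Symp lam, ∀ m : M, ∃ f : unitInterval → E, F.IsHorizontal f ∧
      (∀ t, F.proj (f t) = γ t) ∧ f 0 = p.toFun ((g : Equiv.Perm M) m) ∧ f 1 = q.toFun m := by
  classical
  let FlatAt : (unitInterval → M → E) → unitInterval → Prop := fun Φ t =>
    ∃ e ∈ F.atlas, γ t ∈ e.baseSet ∧ ∃ g : Symp lam, ∀ᶠ t' in 𝓝 t, ∀ m,
      Φ t' m = e.toOpenPartialHomeomorph.symm (γ t', (g : Equiv.Perm M) m)
  let P : unitInterval → Prop := fun s => ∃ Φ, (∀ t ≤ s, FlatAt Φ t) ∧ Φ 0 = p.toFun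
  have hγ : ∀ (e : Bundle.Trivialization M F.proj) (t : unitInterval), γ t ∈ e.baseSet →
      ∀ᶠ t' in 𝓝 t, γ t' ∈ e.baseSet := fun e t ht =>
    γ.continuous.continuousAt.eventually (e.open_baseSet.mem_nhds ht)
  have hsnd : ∀ (e : Bundle.Trivialization M F.proj) (b : B) (m : M), b ∈ e.baseSet →
      (e (e.toOpenPartialHomeomorph.symm (b, m))).2 = m := fun e b m hb => by
    rw [e.apply_symm_apply' hb]
  have P0 : P 0 := by
    obtain ⟨e, he, hb⟩ := F.exists_mem_baseSet (γ 0)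
    obtain ⟨g, hg⟩ := p.symplectic e he hb
    refine ⟨fun t m => e.toOpenPartialHomeomorph.symm (γ t, (g : Equiv.Perm M) m),
      fun t ht => ?_, ?_⟩
    · obtain rfl : t = 0 := le_antisymm ht t.2.1
      exact ⟨e, he, hb, g, Eventually.of_forall fun t' m => rfl⟩
    · funext m
      exact (F.eq_symm_of_snd e (p.proj_toFun m) hb (hg m)).symm
  have Pstep : ∀ s s' : unitInterval, s ≤ s' → ∀ e ∈ F.atlas,
      (∀ t ∈ Icc s s', γ t ∈ e.baseSet) → P s → P s' := by
    rintro s s' hss e he hsub ⟨Φ, hΦ, hΦ0⟩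
    obtain ⟨e₁, he₁, hs₁, g₁, hg₁⟩ := hΦ s le_rfl
    have hs : γ s ∈ e.baseSet := hsub s ⟨le_rfl, hss⟩
    obtain ⟨g, hg⟩ := F.locallyConstant e₁ he₁ e he (γ s) ⟨hs₁, hs⟩
    have hnear : ∀ᶠ t' in 𝓝 s, ∀ m, Φ t' m =
        e.toOpenPartialHomeomorph.symm (γ t', ((g * g₁ : Symp lam) : Equiv.Perm M) m) := by
      filter_upwards [hg₁, hγ e s hs, hγ e₁ s hs₁, γ.continuous.continuousAt.eventually hg]
        with t' h1 h2 h3 h4 m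
      have hp : F.proj (Φ t' m) = γ t' := by
        rw [h1 m]; exact e₁.proj_symm_apply' h3
      refine F.eq_symm_of_snd e hp h2 ?_
      rw [h4 _ hp, h1 m, hsnd e₁ _ _ h3]
      rfl
    refine ⟨fun t => if t ≤ s then Φ t else fun m =>
      e.toOpenPartialHomeomorph.symm (γ t, ((g * g₁ : Symp lam) : Equiv.Perm M) m),
      fun t ht => ?_, ?_⟩
    · rcases lt_trichotomy t s with h | h | h
      · obtain ⟨e₂, he₂, ht₂, g₂, hg₂⟩ := hΦ t h.le
        refine ⟨e₂, he₂, ht₂, g₂, ?_⟩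
        filter_upwards [hg₂, Iio_mem_nhds h] with t' h1 h2 m
        rw [if_pos (le_of_lt h2)]
        exact h1 m
      · subst h
        refine ⟨e, he, hs, g * g₁, ?_⟩
        filter_upwards [hnear] with t' h1 m
        split_ifs
        · exact h1 m
        · rfl
      · refine ⟨e, he, hsub t ⟨h.le, ht⟩, g * g₁, ?_⟩
        filter_upwards [Ioi_mem_nhds h] with t' h1 m
        rw [if_neg (not_le.2 h1)]
    · exact (if_pos s.2.1).trans hΦ0
  have P1 : P 1 := by
    obtain ⟨τ, hτ0, hτm, ⟨n, hn⟩, hτc⟩ := exists_monotone_Icc_subset_open_cover_unitInterval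
      (c := fun e : F.atlas => γ ⁻¹' e.1.baseSet)
      (fun e => e.1.open_baseSet.preimage γ.continuous)
      (fun t _ => by
        obtain ⟨e, he, hb⟩ := F.exists_mem_baseSet (γ t)
        exact mem_iUnion.2 ⟨⟨e, he⟩, hb⟩)
    have : ∀ k, P (τ k) := by
      intro k
      induction k with
      | zero => rw [hτ0]; exact P0
      | succ k ih =>
        obtain ⟨e, he⟩ := hτc k
        exact Pstep _ _ (hτm (Nat.le_succ k)) e.1 e.2 (fun t ht => he ht) ih
    have h := this n
    rwa [hn n le_rfl] at h
  obtain ⟨Φ, hΦ, hΦ0⟩ := P1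
  obtain ⟨e, he, hb, g₁, hg₁⟩ := hΦ 1 le_rfl
  obtain ⟨g₂, hg₂⟩ := q.symplectic e he hb
  refine ⟨g₁⁻¹ * g₂, fun m => ⟨fun t => Φ t (((g₁⁻¹ * g₂ : Symp lam) : Equiv.Perm M) m),
    ⟨?_, ?_⟩, ?_, ?_, ?_⟩⟩
  · rw [continuous_iff_continuousAt]
    intro t
    obtain ⟨e', he', hb', g', hg'⟩ := hΦ t t.2.2
    have hc : ContinuousAt (fun t' => e'.toOpenPartialHomeomorph.symm
        (γ t', (g' : Equiv.Perm M) (((g₁⁻¹ * g₂ : Symp lam) : Equiv.Perm M) m))) t := by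
      refine ContinuousAt.comp (g := e'.toOpenPartialHomeomorph.symm)
        (e'.toOpenPartialHomeomorph.symm.continuousAt (e'.mem_target.2 hb'))
        (γ.continuous.continuousAt.prodMk continuousAt_const)
    refine hc.congr ?_
    filter_upwards [hg'] with t' h
    exact (h _).symm
  · intro t
    obtain ⟨e', he', hb', g', hg'⟩ := hΦ t t.2.2
    refine ⟨e', he', ?_, ?_⟩
    · dsimp only
      rw [hg'.self_of_nhds, e'.proj_symm_apply' hb']
      exact hb'
    · filter_upwards [hg', hγ e' t hb'] with t' h h'
      rw [h, hg'.self_of_nhds, hsnd e' _ _ h', hsnd e' _ _ hb']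
  · intro t
    obtain ⟨e', he', hb', g', hg'⟩ := hΦ t t.2.2
    dsimp only
    rw [hg'.self_of_nhds]
    exact e'.proj_symm_apply' hb'
  · exact congrFun hΦ0 _
  · dsimp only
    rw [hg₁.self_of_nhds]
    refine (F.eq_symm_of_snd e (q.proj_toFun m) hb ((hg₂ m).trans ?_)).symm
    simp

/-- The holonomy of the foliation along a path `γ`, relative to symplectic identifications of `M`
with the fibres: the element `g` of `Symp(M, dλ)` such that parallel transport along `γ` takes
`p (g m)` to `q m`, where `p` and `q` are the identifications over the start and the end. -/
noncomputable def holonomy (p : (b : B) → F.Frame b) (γ : C(unitInterval, B)) : Symp lam :=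
  (F.exists_holonomy γ (p (γ 0)) (p (γ 1))).choose

/-- The singular two-cochain of `B` that represents the characteristic class `𝔊(E)`, i.e. the
pullback of the group cocycle `𝔊_{x,λ}` under the holonomy: on a singular simplex with vertices
`b₀, b₁, b₂` its value is `𝔊_{x,λ}(g, h)`, where `g` and `h` are the holonomies along the edges
`b₀b₁` and `b₁b₂` (so that `gh` is the holonomy along `b₀b₂`). -/
noncomputable def charCochain [IsManifold 𝓘(ℝ, V) ∞ M] [ConnectedSpace M]
    (x : M) (p : (b : B) → F.Frame b) : SingularCochain B 2 :=
  fun s => sympCocycle lam x (F.holonomy p (singularEdge s 0 1))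
    (F.holonomy p (singularEdge s 1 2))

end FoliatedSymplecticBundle

end Bundles

/-! Since `H¹(M; ℝ) = 0`, each closed form `g^*λ - λ` has a primitive `f_g` with `f_g(x) = 0`. Both
`f_g ∘ h + f_h` and `f_{gh}` are primitives of `(gh)^*λ - λ`, so for every point `z` `𝔊(g, h) =
f_g(h z) + f_h(z) - f_{gh}(z)` (`sympCocycle_eq`).

Now choose `z` on the fibre of the subbundle. For every `b` some symplectic `k_b` corrects the frame
over `b`, so that `j_b = k_b⁻¹ ∘ i` is the copy of `L` which the frame carries onto the fibre of
`E'`. Each `j_b^*λ` is again exact, with primitive `ψ_b`. As `E'` is a union of leaves, the holonomy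
`g` along a path `γ` from `b` to `b'` satisfies `g ∘ j_{b'} = j_b ∘ u` for a smooth self-map `u` of
`L`. On the connected `L` two primitives of one form differ by a constant, hence `f_g ∘ j_{b'} =
a(γ) + ψ_b ∘ u - ψ_{b'}` (`Symp.exists_primitive_restrict`). Holonomy is multiplicative on a
singular triangle (`holonomy_singularEdge_mul`), so at `z = j_{b₂}(l)` all the `ψ` terms cancel.
What remains is `a(b₀b₁) + a(b₁b₂) - a(b₀b₂)`: the cochain is the coboundary of `a`
(`IsFoliatedSubbundle.exists_coboundary_eq`). -/

section Forms

variable {V : Type*} [NormedAddCommGroup V] [NormedSpace ℝ V]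
  {M : Type*} [TopologicalSpace M] [ChartedSpace V M]
  {W : Type*} [NormedAddCommGroup W] [NormedSpace ℝ W]
  {N : Type*} [TopologicalSpace N] [ChartedSpace W N]
  {V' : Type*} [NormedAddCommGroup V'] [NormedSpace ℝ V']
  {P : Type*} [TopologicalSpace P] [ChartedSpace V' P]

/-! ### Primitives of one-forms and line integrals. -/

namespace OneForm

/-- `f` is a primitive of `θ`: it is smooth and `θ = df`. -/
def HasPrimitive (θ : OneForm V M) (f : M → ℝ) : Prop :=
  ContMDiff 𝓘(ℝ, V) 𝓘(ℝ, ℝ) ∞ f ∧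
    ∀ (x : M) (v : TangentSpace 𝓘(ℝ, V) x), θ x v = mfderiv 𝓘(ℝ, V) 𝓘(ℝ, ℝ) f x v

theorem HasPrimitive.add {θ η : OneForm V M} {f g : M → ℝ} (hf : θ.HasPrimitive f)
    (hg : η.HasPrimitive g) : (θ + η).HasPrimitive (f + g) := by
  refine ⟨hf.1.add hg.1, fun x v => ?_⟩
  rw [mfderiv_add (hf.1.mdifferentiable (by simp) x) (hg.1.mdifferentiable (by simp) x)]
  exact congrArg₂ (fun a b : ℝ => a + b) (hf.2 x v) (hg.2 x v)

theorem HasPrimitive.sub {θ η : OneForm V M} {f g : M → ℝ} (hf : θ.HasPrimitive f)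
    (hg : η.HasPrimitive g) : (θ - η).HasPrimitive (f - g) := by
  refine ⟨hf.1.sub hg.1, fun x v => ?_⟩
  rw [mfderiv_sub (hf.1.mdifferentiable (by simp) x) (hg.1.mdifferentiable (by simp) x)]
  exact congrArg₂ (fun a b : ℝ => a - b) (hf.2 x v) (hg.2 x v)

theorem HasPrimitive.sub_const {θ : OneForm V M} {f : M → ℝ} (hf : θ.HasPrimitive f) (c : ℝ) :
    θ.HasPrimitive (fun x => f x - c) := by
  have h : (0 : OneForm V M).HasPrimitive (fun _ => c) := by
    refine ⟨contMDiff_const, fun x v => ?_⟩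
    rw [mfderiv_const]
    rfl
  have h' := hf.sub h
  rwa [sub_zero] at h'

theorem HasPrimitive.pullback {θ : OneForm V M} {f : M → ℝ} (hf : θ.HasPrimitive f)
    {u : N → M} (hu : ContMDiff 𝓘(ℝ, W) 𝓘(ℝ, V) ∞ u) :
    (θ.pullback u : OneForm W N).HasPrimitive (f ∘ u) := by
  refine ⟨hf.1.comp hu, fun x v => ?_⟩
  rw [mfderiv_comp x (hf.1.mdifferentiable (by simp) _) (hu.mdifferentiable (by simp) x)]
  exact hf.2 (u x) _

theorem pullback_comp (θ : OneForm V M) {u : N → M} {w : P → N}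
    (hu : ContMDiff 𝓘(ℝ, W) 𝓘(ℝ, V) ∞ u) (hw : ContMDiff 𝓘(ℝ, V') 𝓘(ℝ, W) ∞ w) :
    (θ.pullback (u ∘ w) : OneForm V' P) = (θ.pullback u : OneForm W N).pullback w := by
  funext x
  unfold OneForm.pullback
  rw [mfderiv_comp x (hu.mdifferentiable (by simp) _) (hw.mdifferentiable (by simp) x)]
  rfl

theorem pullback_sub (θ η : OneForm V M) (u : N → M) :
    ((θ - η).pullback u : OneForm W N) = θ.pullback u - η.pullback u := rfl

theorem HasPrimitive.lineIntegral_eq {θ : OneForm V M} {f : M → ℝ} (hf : θ.HasPrimitive f)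
    {γ : ℝ → M} (hγ : ContMDiff 𝓘(ℝ, ℝ) 𝓘(ℝ, V) ∞ γ) :
    θ.lineIntegral γ = f (γ 1) - f (γ 0) := by
  have hc : ContDiff ℝ ∞ (f ∘ γ) := (hf.1.comp hγ).contDiff
  have hd : ∀ t, θ (γ t) (mfderiv 𝓘(ℝ, ℝ) 𝓘(ℝ, V) γ t (1 : ℝ)) = deriv (f ∘ γ) t := by
    intro t
    rw [hf.2, ← fderiv_apply_one_eq_deriv, ← mfderiv_eq_fderiv,
      mfderiv_comp t (hf.1.mdifferentiable (by simp) _) (hγ.mdifferentiable (by simp) t)]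
    rfl
  unfold lineIntegral
  simp_rw [hd]
  rw [intervalIntegral.integral_deriv_eq_sub (fun t _ => hc.differentiable (by simp) t)
    ((hc.continuous_deriv (by simp)).intervalIntegrable _ _)]
  rfl

/-- By the fundamental theorem of calculus the curve hidden in `integralBetween` does not matter for
a form with a primitive. -/
theorem HasPrimitive.integralBetween_eq [IsManifold 𝓘(ℝ, V) ∞ M] [ConnectedSpace M]
    {θ : OneForm V M} {f : M → ℝ} (hf : θ.HasPrimitive f) (x y : M) :
    OneForm.integralBetween (V := V) θ x y = f y - f x := by
  obtain ⟨h, h0, h1⟩ := (exists_smooth_curve (V := V) x y).choose_spec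
  unfold OneForm.integralBetween
  rw [hf.lineIntegral_eq h, h0, h1]

/-- Two primitives of the same one-form on a connected manifold differ by a constant. -/
theorem HasPrimitive.sub_eq_sub [IsManifold 𝓘(ℝ, V) ∞ M] [ConnectedSpace M]
    {θ : OneForm V M} {f g : M → ℝ} (hf : θ.HasPrimitive f) (hg : θ.HasPrimitive g) (x y : M) :
    f y - f x = g y - g x := by
  rw [← hf.integralBetween_eq x y, hg.integralBetween_eq]

/-! ### Pullbacks in charts and the exterior derivative. -/

/-- The pullback of a one-form in charts. -/
theorem inChart_pullback [IsManifold 𝓘(ℝ, V) ∞ M] [IsManifold 𝓘(ℝ, W) ∞ N]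
    (θ : OneForm V M) {u : N → M}
    (hu : ContMDiff 𝓘(ℝ, W) 𝓘(ℝ, V) ∞ u) (x₀ : N) (c : M) {y : W}
    (hy : y ∈ (extChartAt 𝓘(ℝ, W) x₀).target)
    (hc : u ((extChartAt 𝓘(ℝ, W) x₀).symm y) ∈ (extChartAt 𝓘(ℝ, V) c).source) :
    (θ.pullback u : OneForm W N).inChart x₀ y =
      (θ.inChart c (extChartAt 𝓘(ℝ, V) c (u ((extChartAt 𝓘(ℝ, W) x₀).symm y)))).comp
        (fderiv ℝ (extChartAt 𝓘(ℝ, V) c ∘ u ∘ (extChartAt 𝓘(ℝ, W) x₀).symm) y) := by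
  set φ := extChartAt 𝓘(ℝ, W) x₀
  set ψ := extChartAt 𝓘(ℝ, V) c
  have hφ : MDifferentiableAt 𝓘(ℝ, W) 𝓘(ℝ, W) φ.symm y :=
    ((contMDiffOn_extChartAt_symm (I := 𝓘(ℝ, W)) (n := ∞) x₀).contMDiffAt
      ((isOpen_extChartAt_target x₀).mem_nhds hy)).mdifferentiableAt (by simp)
  have hu' : MDifferentiableAt 𝓘(ℝ, W) 𝓘(ℝ, V) u (φ.symm y) :=
    hu.mdifferentiable (by simp) _
  have hψ : MDifferentiableAt 𝓘(ℝ, V) 𝓘(ℝ, V) ψ (u (φ.symm y)) :=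
    ((contMDiffOn_extChartAt (I := 𝓘(ℝ, V)) (n := ∞) (x := c)).contMDiffAt
      ((chartAt V c).open_source.mem_nhds (by simpa [ψ] using hc))).mdifferentiableAt (by simp)
  have hψs : MDifferentiableAt 𝓘(ℝ, V) 𝓘(ℝ, V) ψ.symm (ψ (u (φ.symm y))) :=
    ((contMDiffOn_extChartAt_symm (I := 𝓘(ℝ, V)) (n := ∞) c).contMDiffAt
      ((isOpen_extChartAt_target c).mem_nhds (ψ.map_source hc))).mdifferentiableAt (by simp)
  have hG : MDifferentiableAt 𝓘(ℝ, W) 𝓘(ℝ, V) (ψ ∘ u ∘ φ.symm) y :=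
    hψ.comp y (hu'.comp y hφ)
  have hev : u ∘ φ.symm =ᶠ[𝓝 y] ψ.symm ∘ (ψ ∘ u ∘ φ.symm) := by
    have : ∀ᶠ z in 𝓝 y, u (φ.symm z) ∈ ψ.source :=
      (hu'.comp y hφ).continuousAt.eventually ((isOpen_extChartAt_source c).mem_nhds hc)
    filter_upwards [this] with z hz
    exact (ψ.left_inv hz).symm
  have h1 : (mfderiv 𝓘(ℝ, W) 𝓘(ℝ, V) u (φ.symm y)).comp
      (mfderiv 𝓘(ℝ, W) 𝓘(ℝ, W) φ.symm y) =
      (mfderiv 𝓘(ℝ, V) 𝓘(ℝ, V) ψ.symm (ψ (u (φ.symm y)))).comp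
        (mfderiv 𝓘(ℝ, W) 𝓘(ℝ, V) (ψ ∘ u ∘ φ.symm) y) := by
    rw [← mfderiv_comp y hu' hφ, hev.mfderiv_eq]
    exact mfderiv_comp y hψs hG
  rw [mfderiv_eq_fderiv] at h1
  have hp : ψ.symm (ψ (u (φ.symm y))) = u (φ.symm y) := ψ.left_inv hc
  -- The type of `θ z` depends on `z`, so the equality of points is transported by substitution
  -- instead of rewriting.
  have hθ : ∀ z, z = u (φ.symm y) → ∀ v : V, θ (u (φ.symm y)) v = θ z v := by
    rintro z rfl v; rfl
  ext v
  refine (hθ _ hp _).trans ?_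
  exact congrArg (θ (ψ.symm (ψ (u (φ.symm y)))))
    (congrArg (fun A : W →L[ℝ] V => A v) h1)

theorem IsSmooth.sub {θ η : OneForm V M} (hθ : θ.IsSmooth) (hη : η.IsSmooth) :
    (θ - η).IsSmooth := fun x₀ => ((hθ x₀).sub (hη x₀)).congr fun _ _ => rfl

theorem contDiffAt_inCharts [IsManifold 𝓘(ℝ, V) ∞ M] [IsManifold 𝓘(ℝ, W) ∞ N]
    {u : N → M} (hu : ContMDiff 𝓘(ℝ, W) 𝓘(ℝ, V) ∞ u) (x₀ : N) (c : M) {y : W}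
    (hy : y ∈ (extChartAt 𝓘(ℝ, W) x₀).target)
    (hc : u ((extChartAt 𝓘(ℝ, W) x₀).symm y) ∈ (extChartAt 𝓘(ℝ, V) c).source) :
    ContDiffAt ℝ ∞ (extChartAt 𝓘(ℝ, V) c ∘ u ∘ (extChartAt 𝓘(ℝ, W) x₀).symm) y := by
  refine ContMDiffAt.contDiffAt ?_
  have hφ := (contMDiffOn_extChartAt_symm (I := 𝓘(ℝ, W)) (n := ∞) x₀).contMDiffAt
      ((isOpen_extChartAt_target x₀).mem_nhds hy)
  have hψ := (contMDiffOn_extChartAt (I := 𝓘(ℝ, V)) (n := ∞) (x := c)).contMDiffAt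
      ((chartAt V c).open_source.mem_nhds (by simpa using hc))
  exact ContMDiffAt.comp y hψ (ContMDiffAt.comp y (hu _) hφ)

/-- The chart formula is needed on a neighbourhood because both sides will be differentiated. -/
theorem eventually_inChart_pullback [IsManifold 𝓘(ℝ, V) ∞ M] [IsManifold 𝓘(ℝ, W) ∞ N]
    (θ : OneForm V M) {u : N → M}
    (hu : ContMDiff 𝓘(ℝ, W) 𝓘(ℝ, V) ∞ u) (x₀ : N) (c : M) {y : W}
    (hy : y ∈ (extChartAt 𝓘(ℝ, W) x₀).target)
    (hc : u ((extChartAt 𝓘(ℝ, W) x₀).symm y) ∈ (extChartAt 𝓘(ℝ, V) c).source) :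
    (θ.pullback u : OneForm W N).inChart x₀ =ᶠ[𝓝 y] fun z =>
      (θ.inChart c ((extChartAt 𝓘(ℝ, V) c ∘ u ∘ (extChartAt 𝓘(ℝ, W) x₀).symm) z)).comp
        (fderiv ℝ (extChartAt 𝓘(ℝ, V) c ∘ u ∘ (extChartAt 𝓘(ℝ, W) x₀).symm) z) := by
  have hφ := ((contMDiffOn_extChartAt_symm (I := 𝓘(ℝ, W)) (n := ∞) x₀).contMDiffAt
      ((isOpen_extChartAt_target x₀).mem_nhds hy)).continuousAt
  filter_upwards [(isOpen_extChartAt_target x₀).mem_nhds hy,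
    (hu.continuous.continuousAt.comp hφ).eventually
      ((isOpen_extChartAt_source (I := 𝓘(ℝ, V)) c).mem_nhds hc)] with z hz hz'
  exact inChart_pullback θ hu x₀ c hz hz'

theorem IsSmooth.contDiffAt {θ : OneForm V M} (hθ : θ.IsSmooth) (c : M) {y : V}
    (hy : y ∈ (extChartAt 𝓘(ℝ, V) c).target) : ContDiffAt ℝ ∞ (θ.inChart c) y :=
  (hθ c).contDiffAt ((isOpen_extChartAt_target c).mem_nhds hy)

theorem IsSmooth.pullback [IsManifold 𝓘(ℝ, V) ∞ M] [IsManifold 𝓘(ℝ, W) ∞ N]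
    {θ : OneForm V M} (hθ : θ.IsSmooth) {u : N → M} (hu : ContMDiff 𝓘(ℝ, W) 𝓘(ℝ, V) ∞ u) :
    (θ.pullback u : OneForm W N).IsSmooth := by
  intro x₀ y hy
  refine ContDiffAt.contDiffWithinAt ?_
  have hc := mem_extChartAt_source (I := 𝓘(ℝ, V)) (u ((extChartAt 𝓘(ℝ, W) x₀).symm y))
  have hG := contDiffAt_inCharts hu x₀ _ hy hc
  refine ContDiffAt.congr_of_eventuallyEq ?_ (eventually_inChart_pullback θ hu x₀ _ hy hc)
  exact ((hθ.contDiffAt _ ((extChartAt 𝓘(ℝ, V) _).map_source hc)).comp y hG).clm_comp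
    (hG.fderiv_right (by simp))

/-- The exterior derivative commutes with pullbacks. -/
theorem IsSmooth.extD_pullback [IsManifold 𝓘(ℝ, V) ∞ M] [IsManifold 𝓘(ℝ, W) ∞ N]
    {θ : OneForm V M} (hθ : θ.IsSmooth) {u : N → M} (hu : ContMDiff 𝓘(ℝ, W) 𝓘(ℝ, V) ∞ u)
    (x : N) (v w : TangentSpace 𝓘(ℝ, W) x) :
    (θ.pullback u : OneForm W N).extD x v w =
      θ.extD (u x) (mfderiv 𝓘(ℝ, W) 𝓘(ℝ, V) u x v) (mfderiv 𝓘(ℝ, W) 𝓘(ℝ, V) u x w) := by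
  set y := extChartAt 𝓘(ℝ, W) x x with hy_def
  have hy : y ∈ (extChartAt 𝓘(ℝ, W) x).target := mem_extChartAt_target x
  have hyx : (extChartAt 𝓘(ℝ, W) x).symm y = x := extChartAt_to_inv x
  have hc : u ((extChartAt 𝓘(ℝ, W) x).symm y) ∈ (extChartAt 𝓘(ℝ, V) (u x)).source := by
    rw [hyx]; exact mem_extChartAt_source _
  have hG := contDiffAt_inCharts hu x _ hy hc
  have hev := eventually_inChart_pullback θ hu x _ hy hc
  set G := extChartAt 𝓘(ℝ, V) (u x) ∘ u ∘ (extChartAt 𝓘(ℝ, W) x).symm with hGdef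
  have hGy : G y = extChartAt 𝓘(ℝ, V) (u x) (u x) := by
    rw [hGdef, Function.comp_apply, Function.comp_apply, hyx]
  -- The manifold derivative is defined through the preferred charts at `x` and `u x`, the same ones
  -- that `extD` uses.
  have hmf : mfderiv 𝓘(ℝ, W) 𝓘(ℝ, V) u x = fderiv ℝ G y := by
    refine (hu.mdifferentiable (by simp) x).mfderiv.trans ?_
    change fderivWithin ℝ G (range 𝓘(ℝ, W)) y = _
    rw [ModelWithCorners.range_eq_univ, fderivWithin_univ]
  have hA : DifferentiableAt ℝ (θ.inChart (u x)) (G y) := by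
    rw [hGy]
    exact (hθ.contDiffAt _ (mem_extChartAt_target _)).differentiableAt (by simp)
  have hDG : DifferentiableAt ℝ (fderiv ℝ G) y :=
    (hG.fderiv_right (m := ∞) (by simp)).differentiableAt (by simp)
  have hGd : DifferentiableAt ℝ G y := hG.differentiableAt (by simp)
  have hsymm : IsSymmSndFDerivAt ℝ G y := hG.isSymmSndFDerivAt (by
    rw [minSmoothness_of_isRCLikeNormedField]
    exact ENat.LEInfty.out)
  -- The product rule leaves a term with the second derivative of `G`; being symmetric in `a` and
  -- `b`, it drops out of the antisymmetrization.
  have key : ∀ a b : W, fderiv ℝ ((θ.pullback u : OneForm W N).inChart x) y a b =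
      fderiv ℝ (θ.inChart (u x)) (G y) (fderiv ℝ G y a) (fderiv ℝ G y b) +
        θ.inChart (u x) (G y) (fderiv ℝ (fderiv ℝ G) y a b) := by
    intro a b
    rw [hev.fderiv_eq]
    have h1 : HasFDerivAt (fun z => θ.inChart (u x) (G z))
        ((fderiv ℝ (θ.inChart (u x)) (G y)).comp (fderiv ℝ G y)) y :=
      HasFDerivAt.comp y hA.hasFDerivAt hGd.hasFDerivAt
    rw [(h1.clm_comp hDG.hasFDerivAt).fderiv]
    simp [add_comm]
  have kv := key v w
  have kw := key w v
  rw [hsymm.eq w v] at kw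
  unfold OneForm.extD
  rw [hmf, ← hGy, ← hy_def]
  refine (congrArg₂ (fun a b : ℝ => a - b) kv kw).trans ?_
  exact add_sub_add_right_eq_sub _ _ _

theorem IsSmooth.extD_sub {θ η : OneForm V M} (hθ : θ.IsSmooth) (hη : η.IsSmooth) (x : M)
    (v w : TangentSpace 𝓘(ℝ, V) x) : (θ - η).extD x v w = θ.extD x v w - η.extD x v w := by
  have h1 := (hθ.contDiffAt x (mem_extChartAt_target x)).differentiableAt (by simp)
  have h2 := (hη.contDiffAt x (mem_extChartAt_target x)).differentiableAt (by simp)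
  have h : fderiv ℝ ((θ - η).inChart x) (extChartAt 𝓘(ℝ, V) x x) =
      fderiv ℝ (θ.inChart x) (extChartAt 𝓘(ℝ, V) x x) -
        fderiv ℝ (η.inChart x) (extChartAt 𝓘(ℝ, V) x x) := fderiv_sub h1 h2
  have h' : ∀ a b : V, fderiv ℝ ((θ - η).inChart x) (extChartAt 𝓘(ℝ, V) x x) a b =
      fderiv ℝ (θ.inChart x) (extChartAt 𝓘(ℝ, V) x x) a b -
        fderiv ℝ (η.inChart x) (extChartAt 𝓘(ℝ, V) x x) a b := by
    intro a b; rw [h]; rfl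
  unfold OneForm.extD
  refine (congrArg₂ (fun a b : ℝ => a - b) (h' v w) (h' w v)).trans ?_
  exact sub_sub_sub_comm _ _ _ _

end OneForm

/-! ### The cocycle in terms of primitives. -/

section Symplectic

variable {lam : OneForm V M}

theorem Symp.contMDiff (g : Symp lam) : ContMDiff 𝓘(ℝ, V) 𝓘(ℝ, V) ∞ (g : Equiv.Perm M) := g.2.1

variable [IsManifold 𝓘(ℝ, V) ∞ M]

/-- For a symplectic diffeomorphism `g`, the one-form `g^*λ - λ` is closed. -/
theorem Symp.isClosed_pullback_sub (hlam : lam.IsSmooth) (g : Symp lam) :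
    (lam.pullback (g : Equiv.Perm M) - lam : OneForm V M).IsClosed := by
  have hs : (lam.pullback (g : Equiv.Perm M) : OneForm V M).IsSmooth := hlam.pullback (Symp.contMDiff g)
  refine ⟨hs.sub hlam, fun x v w => ?_⟩
  rw [hs.extD_sub hlam, hlam.extD_pullback (Symp.contMDiff g), g.2.2.2, sub_self]

theorem Symp.exists_primitive (hlam : lam.IsSmooth) (hM : FirstDeRhamVanishes V M) (x : M)
    (g : Symp lam) : ∃ f : M → ℝ,
      (lam.pullback (g : Equiv.Perm M) - lam : OneForm V M).HasPrimitive f ∧ f x = 0 := by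
  obtain ⟨f, hf⟩ := hM _ (Symp.isClosed_pullback_sub hlam g)
  exact ⟨fun y => f y - f x, OneForm.HasPrimitive.sub_const hf _, sub_self _⟩

/-- The cocycle `𝔊_{x,λ}` in terms of primitives of the forms `g^*λ - λ` that vanish at `x`: it is
formally the coboundary of the evaluation of the primitives at an arbitrary point. -/
theorem sympCocycle_eq [ConnectedSpace M] {x : M} {g h : Symp lam} {f₁ f₂ f₃ : M → ℝ}
    (h₁ : (lam.pullback (g : Equiv.Perm M) - lam : OneForm V M).HasPrimitive f₁)
    (h₂ : (lam.pullback (h : Equiv.Perm M) - lam : OneForm V M).HasPrimitive f₂)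
    (h₃ : (lam.pullback ((g * h : Symp lam) : Equiv.Perm M) - lam : OneForm V M).HasPrimitive f₃)
    (hx₁ : f₁ x = 0) (hx₂ : f₂ x = 0) (hx₃ : f₃ x = 0) (z : M) :
    sympCocycle lam x g h = f₁ ((h : Equiv.Perm M) z) + f₂ z - f₃ z := by
  -- `(gh)^*λ - λ = h^*(g^*λ - λ) + (h^*λ - λ)`; the two resulting primitives are then compared at
  -- `x` and `z`.
  have hsum := (h₁.pullback (Symp.contMDiff h)).add h₂
  have hform : ((lam.pullback (g : Equiv.Perm M) - lam : OneForm V M).pullback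
      (h : Equiv.Perm M) + (lam.pullback (h : Equiv.Perm M) - lam) : OneForm V M) =
      lam.pullback ((g * h : Symp lam) : Equiv.Perm M) - lam := by
    have : (((g * h : Symp lam) : Equiv.Perm M) : M → M) =
        (g : Equiv.Perm M) ∘ (h : Equiv.Perm M) := rfl
    rw [this, OneForm.pullback_comp lam (Symp.contMDiff g) (Symp.contMDiff h), OneForm.pullback_sub]
    abel
  rw [hform] at hsum
  have := hsum.sub_eq_sub h₃ x z
  simp only [Pi.add_apply, Function.comp_apply, hx₂, hx₃] at this
  unfold sympCocycle
  rw [h₁.integralBetween_eq, hx₁]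
  linarith

end Symplectic

end Forms

/-! ### Horizontal lifts and multiplicativity of holonomy. -/

section Holonomy

variable {V : Type*} [NormedAddCommGroup V] [NormedSpace ℝ V]
  {M : Type*} [TopologicalSpace M] [ChartedSpace V M]

namespace FoliatedSymplecticBundle

variable {lam : OneForm V M} {B E : Type*} [TopologicalSpace B] [TopologicalSpace E]
  {F : FoliatedSymplecticBundle lam B E} {K K' : Type*} [TopologicalSpace K] [TopologicalSpace K']

theorem eq_of_snd_eq {e : Bundle.Trivialization M F.proj} {z w : E}
    (hp : F.proj z = F.proj w) (hb : F.proj w ∈ e.baseSet) (h : (e z).2 = (e w).2) : z = w :=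
  (F.eq_symm_of_snd e hp hb h).trans (F.eq_symm_of_snd e rfl hb rfl).symm

theorem IsHorizontal.comp {f : K → E} (hf : F.IsHorizontal f) {u : K' → K} (hu : Continuous u) :
    F.IsHorizontal (f ∘ u) := by
  refine ⟨hf.1.comp hu, fun k => ?_⟩
  obtain ⟨e, he, hb, h⟩ := hf.2 (u k)
  exact ⟨e, he, hb, hu.continuousAt.eventually h⟩

/-- The fibre coordinates in two charts of maps with locally constant fibre coordinate. -/
theorem eventually_snd_eq {f : K → E} {β : K → B} {k : K} (hβ : ContinuousAt β k)
    (hf : ∀ k, F.proj (f k) = β k) {e e' : Bundle.Trivialization M F.proj} (he : e ∈ F.atlas)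
    (he' : e' ∈ F.atlas) (hb : β k ∈ e.baseSet) (hb' : β k ∈ e'.baseSet)
    (h : ∀ᶠ k' in 𝓝 k, (e (f k')).2 = (e (f k)).2) :
    ∀ᶠ k' in 𝓝 k, (e' (f k')).2 = (e' (f k)).2 := by
  obtain ⟨g, hg⟩ := F.locallyConstant e he e' he' (β k) ⟨hb, hb'⟩
  filter_upwards [h, hβ.eventually hg] with k' h1 h2
  rw [h2 _ (hf k'), h1, ← hg.self_of_nhds _ (hf k)]

theorem IsHorizontal.continuous_proj {f : K → E} (hf : F.IsHorizontal f) :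
    Continuous fun k => F.proj (f k) := by
  rw [continuous_iff_continuousAt]
  intro k
  obtain ⟨e, -, hb, -⟩ := hf.2 k
  exact ContinuousAt.comp (g := F.proj) (e.continuousAt_proj (e.mem_source.2 hb))
    hf.1.continuousAt

theorem IsHorizontal.eventually_snd_eq {f : K → E} (hf : F.IsHorizontal f) {k : K}
    {e : Bundle.Trivialization M F.proj} (he : e ∈ F.atlas) (hb : F.proj (f k) ∈ e.baseSet) :
    ∀ᶠ k' in 𝓝 k, (e (f k')).2 = (e (f k)).2 := by
  obtain ⟨e₁, he₁, hb₁, h⟩ := hf.2 k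
  exact FoliatedSymplecticBundle.eventually_snd_eq hf.continuous_proj.continuousAt
    (fun _ => rfl) he₁ he hb₁ hb h

/-- Horizontal lifts are determined by their value at one point. -/
theorem IsHorizontal.eq_of_eq [PreconnectedSpace K] {f f' : K → E} (hf : F.IsHorizontal f)
    (hf' : F.IsHorizontal f') (hp : ∀ k, F.proj (f k) = F.proj (f' k)) {k₀ : K}
    (h₀ : f k₀ = f' k₀) : f = f' := by
  -- Whether the two lifts agree is a locally constant property. This gives openness and closedness
  -- at once, without separation of `E`.
  have key : ∀ k, ∀ᶠ k' in 𝓝 k, (f k' = f' k' ↔ f k = f' k) := by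
    intro k
    obtain ⟨e, he, hb⟩ := F.exists_mem_baseSet (F.proj (f' k))
    filter_upwards [hf.eventually_snd_eq he (by rwa [hp]), hf'.eventually_snd_eq he hb,
      hf'.continuous_proj.continuousAt.eventually (e.open_baseSet.mem_nhds hb)] with k' h1 h2 h3
    constructor
    · intro h
      exact eq_of_snd_eq (hp k) hb (by rw [← h1, ← h2, h])
    · intro h
      exact eq_of_snd_eq (hp k') h3 (by rw [h1, h2, h])
  have hc : IsClopen {k | f k = f' k} := by
    constructor
    · rw [← isOpen_compl_iff, isOpen_iff_mem_nhds]
      intro k hk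
      filter_upwards [key k] with k' h h'
      exact hk (h.1 h')
    · rw [isOpen_iff_mem_nhds]
      intro k hk
      filter_upwards [key k] with k' h
      exact h.2 hk
  funext k
  have hk : k ∈ {k | f k = f' k} := by rw [hc.eq_univ ⟨k₀, h₀⟩]; trivial
  exact hk

/-- Continuity is automatic: locally the lift is an inverse chart applied to `β` and a constant
fibre coordinate. -/
theorem isHorizontal_of_lift {f : K → E} {β : K → B} (hβ : Continuous β)
    (hf : ∀ k, F.proj (f k) = β k)
    (h : ∀ k, ∃ e ∈ F.atlas, β k ∈ e.baseSet ∧ ∀ᶠ k' in 𝓝 k, (e (f k')).2 = (e (f k)).2) :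
    F.IsHorizontal f := by
  refine ⟨?_, fun k => ?_⟩
  · rw [continuous_iff_continuousAt]
    intro k
    obtain ⟨e, he, hb, h⟩ := h k
    have hc : ContinuousAt (fun k' => e.toOpenPartialHomeomorph.symm (β k', (e (f k)).2)) k :=
      ContinuousAt.comp (g := e.toOpenPartialHomeomorph.symm)
        (e.toOpenPartialHomeomorph.symm.continuousAt (e.mem_target.2 hb))
        (hβ.continuousAt.prodMk continuousAt_const)
    refine hc.congr ?_
    filter_upwards [h, hβ.continuousAt.eventually (e.open_baseSet.mem_nhds hb)] with k' h1 h2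
    exact (F.eq_symm_of_snd e (hf k') h2 h1).symm
  · obtain ⟨e, he, hb, h⟩ := h k
    exact ⟨e, he, by rwa [hf], h⟩

namespace Frame

theorem injective {b : B} (p : F.Frame b) : Function.Injective p.toFun := by
  intro m m' h
  obtain ⟨e, he, hb⟩ := F.exists_mem_baseSet b
  obtain ⟨g, hg⟩ := p.symplectic e he hb
  exact (g : Equiv.Perm M).injective (by rw [← hg, ← hg, h])

theorem exists_toFun_eq {b : B} (p : F.Frame b) {z : E} (hz : F.proj z = b) :
    ∃ m, p.toFun m = z := by
  obtain ⟨e, he, hb⟩ := F.exists_mem_baseSet b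
  obtain ⟨g, hg⟩ := p.symplectic e he hb
  refine ⟨(g : Equiv.Perm M).symm (e z).2, ?_⟩
  refine eq_of_snd_eq (e := e) (by rw [p.proj_toFun, hz]) (by rwa [hz]) ?_
  rw [hg, Equiv.apply_symm_apply]

end Frame

theorem exists_horizontal_lift (p : (b : B) → F.Frame b) (γ : C(unitInterval, B)) {z : E}
    (hz : F.proj z = γ 0) : ∃ f : unitInterval → E, F.IsHorizontal f ∧
      (∀ t, F.proj (f t) = γ t) ∧ f 0 = z := by
  obtain ⟨g, hg⟩ := F.exists_holonomy γ (p (γ 0)) (p (γ 1))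
  obtain ⟨m, hm⟩ := (p (γ 0)).exists_toFun_eq hz
  obtain ⟨f, hf, hfγ, hf0, -⟩ := hg ((g : Equiv.Perm M).symm m)
  exact ⟨f, hf, hfγ, by rw [hf0, Equiv.apply_symm_apply, hm]⟩

/-- Horizontal lifts of a continuous family of paths with the same starting point fit together. -/
theorem exists_eventually_snd_eq {γ : K × unitInterval → B} (hγ : Continuous γ)
    {f : K × unitInterval → E} (hf : ∀ s, F.IsHorizontal fun t => f (s, t))
    (hfγ : ∀ q, F.proj (f q) = γ q) {z : E} (h0 : ∀ s, f (s, 0) = z) (q₀ : K × unitInterval) :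
    ∃ e ∈ F.atlas, γ q₀ ∈ e.baseSet ∧ ∀ᶠ q in 𝓝 q₀, (e (f q)).2 = (e (f q₀)).2 := by
  obtain ⟨s₀, t₀⟩ := q₀
  -- Local constancy in the parameter `s` at time `t`. It holds at time `0`, where all lifts start
  -- at `z`, and is propagated along the connected interval.
  let T : unitInterval → Prop := fun t => ∃ e ∈ F.atlas, γ (s₀, t) ∈ e.baseSet ∧
    ∀ᶠ s in 𝓝 s₀, (e (f (s, t))).2 = (e (f (s₀, t))).2
  have hs : ∀ t, Continuous fun s : K => γ (s, t) := fun t => hγ.comp (by fun_prop)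
  -- On a box `U × J` inside one chart domain each lift has constant fibre coordinate along `J`, so
  -- knowledge at one time of `J` extends to all of `J`, uniformly in `s` near `s₀`.
  have step : ∀ t, ∃ e ∈ F.atlas, ∃ J ∈ 𝓝 t, (∀ t' ∈ J, γ (s₀, t') ∈ e.baseSet) ∧
      ∀ t₁ ∈ J, T t₁ → ∀ᶠ s in 𝓝 s₀, ∀ t₂ ∈ J, (e (f (s, t₂))).2 = (e (f (s₀, t₁))).2 := by
    intro t
    obtain ⟨e, he, hb⟩ := F.exists_mem_baseSet (γ (s₀, t))
    have hn : γ ⁻¹' e.baseSet ∈ 𝓝 (s₀, t) :=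
      hγ.continuousAt.preimage_mem_nhds (e.open_baseSet.mem_nhds hb)
    rw [nhds_prod_eq, mem_prod_iff] at hn
    obtain ⟨U, hU, J', hJ', hUJ⟩ := hn
    -- The neighbourhood is shrunk to an interval, since constancy along it needs connectedness.
    obtain ⟨b, c, -, hJ, hsub⟩ := exists_Icc_mem_subset_of_mem_nhds hJ'
    have hUJ' : ∀ s ∈ U, ∀ t' ∈ Icc b c, γ (s, t') ∈ e.baseSet := fun s hs t' ht' =>
      hUJ (mk_mem_prod hs (hsub ht'))
    have hs₀ : s₀ ∈ U := mem_of_mem_nhds hU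
    have hconst : ∀ s ∈ U, ∀ t₁ ∈ Icc b c, ∀ t₂ ∈ Icc b c,
        (e (f (s, t₁))).2 = (e (f (s, t₂))).2 := by
      intro s hs t₁ ht₁ t₂ ht₂
      refine isPreconnected_Icc.induction₂ (fun t₁ t₂ => (e (f (s, t₁))).2 = (e (f (s, t₂))).2)
        (fun t' ht' => ?_) (fun x y w _ _ _ h h' => h.trans h') (fun x y _ _ h => h.symm) ht₁ ht₂
      refine mem_nhdsWithin_of_mem_nhds ?_
      filter_upwards [(hf s).eventually_snd_eq he (k := t')
        (by rw [hfγ]; exact hUJ' s hs t' ht')] with t'' h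
      exact h.symm
    refine ⟨e, he, Icc b c, hJ, hUJ' s₀ hs₀, fun t₁ ht₁ hT => ?_⟩
    obtain ⟨e₁, he₁, hb₁, h₁⟩ := hT
    filter_upwards [hU, eventually_snd_eq (hs t₁).continuousAt (fun s => hfγ (s, t₁)) he₁ he hb₁
      (hUJ' s₀ hs₀ t₁ ht₁) h₁] with s hsU h t₂ ht₂
    rw [hconst s hsU t₂ ht₂ t₁ ht₁, h]
  have hT0 : T 0 := by
    obtain ⟨e, he, hb⟩ := F.exists_mem_baseSet (γ (s₀, 0))
    exact ⟨e, he, hb, Eventually.of_forall fun s => by rw [h0, h0]⟩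
  have hT : ∀ t, T t := by
    intro t
    refine isPreconnected_univ.induction₂' (fun t t' => T t → T t') (fun t _ => ?_)
      (fun x y w _ _ _ h h' hx => h' (h hx)) (mem_univ 0) (mem_univ t) hT0
    refine mem_nhdsWithin_of_mem_nhds ?_
    obtain ⟨e, he, J, hJ, hb, h⟩ := step t
    have hstep : ∀ t₁ ∈ J, ∀ t₂ ∈ J, T t₁ → T t₂ := fun t₁ ht₁ t₂ ht₂ hT₁ => by
      have hev := h t₁ ht₁ hT₁
      refine ⟨e, he, hb t₂ ht₂, ?_⟩
      filter_upwards [hev] with s hs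
      rw [hs t₂ ht₂, hev.self_of_nhds t₂ ht₂]
    filter_upwards [hJ] with t' ht'
    exact ⟨hstep t (mem_of_mem_nhds hJ) t' ht', hstep t' ht' t (mem_of_mem_nhds hJ)⟩
  obtain ⟨e, he, J, hJ, hb, h⟩ := step t₀
  refine ⟨e, he, hb t₀ (mem_of_mem_nhds hJ), ?_⟩
  have hev := h t₀ (mem_of_mem_nhds hJ) (hT t₀)
  rw [nhds_prod_eq]
  filter_upwards [hev.prod_mk hJ] with q hq
  exact hq.1 q.2 hq.2

/-- A map from a space that contracts to a point `v` relative to `v` lifts horizontally. -/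
theorem exists_horizontal_lift_of_contraction (p : (b : B) → F.Frame b) (β : C(K, B)) {v : K}
    (H : C(K × unitInterval, K)) (H0 : ∀ s, H (s, 0) = v) (H1 : ∀ s, H (s, 1) = s)
    (Hv : ∀ t, H (v, t) = v) {z : E} (hz : F.proj z = β v) :
    ∃ f : K → E, F.IsHorizontal f ∧ (∀ k, F.proj (f k) = β k) ∧ f v = z := by
  have hlift : ∀ s : K, ∃ f : unitInterval → E, F.IsHorizontal f ∧
      (∀ t, F.proj (f t) = β (H (s, t))) ∧ f 0 = z := fun s =>
    exists_horizontal_lift p ((β.comp H).comp ⟨fun t => (s, t), by fun_prop⟩)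
      (by simpa [H0] using hz)
  choose f hf hfβ hf0 using hlift
  have hγ : Continuous fun q : K × unitInterval => β (H q) := by fun_prop
  have key := exists_eventually_snd_eq (F := F) hγ (f := fun q => f q.1 q.2) hf
    (fun q => hfβ q.1 q.2) hf0
  -- The value at `s` is the endpoint of the lift of the path `t ↦ β (H (s, t))` from `β v` to `β
  -- s`. At `v` this path is constant, so by uniqueness its lift stays at `z`.
  refine ⟨fun s => f s 1, ?_, fun k => by rw [hfβ, H1], ?_⟩
  · refine isHorizontal_of_lift β.continuous (fun k => by rw [hfβ, H1]) fun k => ?_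
    obtain ⟨e, he, hb, h⟩ := key (k, 1)
    refine ⟨e, he, by simpa only [H1] using hb, ?_⟩
    exact (Continuous.prodMk_left (1 : unitInterval)).continuousAt.eventually h
  · have hc : F.IsHorizontal fun _ : unitInterval => z := by
      refine isHorizontal_of_lift (β := fun _ => β v) continuous_const (fun _ => hz) fun _ => ?_
      obtain ⟨e, he, hb⟩ := F.exists_mem_baseSet (β v)
      exact ⟨e, he, hb, Eventually.of_forall fun _ => rfl⟩
    exact congrFun ((hf v).eq_of_eq hc (fun t => by rw [hfβ, Hv, hz]) (hf0 v)) 1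

/-- By convexity, straight lines contract the simplex to `v` while fixing `v`. -/
theorem exists_horizontal_lift_simplex {n : ℕ} (p : (b : B) → F.Frame b)
    (τ : C(stdSimplex ℝ (Fin n), B)) (v : stdSimplex ℝ (Fin n)) {z : E} (hz : F.proj z = τ v) :
    ∃ f : stdSimplex ℝ (Fin n) → E, F.IsHorizontal f ∧ (∀ k, F.proj (f k) = τ k) ∧ f v = z := by
  have hmem : ∀ q : stdSimplex ℝ (Fin n) × unitInterval,
      (v : Fin n → ℝ) + (q.2 : ℝ) • ((q.1 : Fin n → ℝ) - v) ∈ stdSimplex ℝ (Fin n) := fun q =>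
    (convex_stdSimplex ℝ (Fin n)).add_smul_sub_mem v.2 q.1.2 ⟨q.2.2.1, q.2.2.2⟩
  refine exists_horizontal_lift_of_contraction p τ
    ⟨fun q => ⟨(v : Fin n → ℝ) + (q.2 : ℝ) • ((q.1 : Fin n → ℝ) - v), hmem q⟩, ?_⟩
    (fun s => Subtype.ext ?_) (fun s => Subtype.ext ?_) (fun t => Subtype.ext ?_) hz
  · refine Continuous.subtype_mk ?_ _
    exact continuous_const.add ((continuous_subtype_val.comp continuous_snd).smul
      ((continuous_subtype_val.comp continuous_fst).sub continuous_const))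
  · simp only [Set.Icc.coe_zero, ContinuousMap.coe_mk, zero_smul, add_zero]
    rfl
  · simp only [Set.Icc.coe_one, ContinuousMap.coe_mk, one_smul, add_sub_cancel]
    rfl
  · simp only [ContinuousMap.coe_mk, sub_self, smul_zero, add_zero]
    rfl

/-- Uniqueness of lifts lets the chosen holonomy be read off from any horizontal lift. The endpoints
are variables because frames depend on the base point, and the ends of a singular edge are vertices
only up to a proved equality. -/
theorem holonomy_apply (p : (b : B) → F.Frame b) (γ : C(unitInterval, B)) {b₀ b₁ : B}
    (h₀ : γ 0 = b₀) (h₁ : γ 1 = b₁) {f : unitInterval → E} (hf : F.IsHorizontal f)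
    (hfγ : ∀ t, F.proj (f t) = γ t) {m : M} (hm : f 1 = (p b₁).toFun m) :
    f 0 = (p b₀).toFun ((F.holonomy p γ : Equiv.Perm M) m) := by
  subst h₀ h₁
  obtain ⟨f', hf', hfγ', h0, h1⟩ := (F.exists_holonomy γ (p (γ 0)) (p (γ 1))).choose_spec m
  rw [hf.eq_of_eq hf' (fun t => by rw [hfγ, hfγ']) (hm.trans h1.symm), h0]
  rfl

/-- The two points lie on one leaf: a horizontal lift joins them, and its reversal gives the
converse. -/
theorem holonomy_mem_iff (p : (b : B) → F.Frame b) (γ : C(unitInterval, B)) {E' : Set E}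
    (hE' : ∀ z ∈ E', F.leaf z ⊆ E') (m : M) :
    (p (γ 0)).toFun ((F.holonomy p γ : Equiv.Perm M) m) ∈ E' ↔ (p (γ 1)).toFun m ∈ E' := by
  obtain ⟨f, hf, -, h0, h1⟩ := (F.exists_holonomy γ (p (γ 0)) (p (γ 1))).choose_spec m
  constructor
  · intro h
    exact hE' _ h ⟨f, hf, h0, h1⟩
  · intro h
    exact hE' _ h ⟨f ∘ unitInterval.symm, hf.comp unitInterval.continuous_symm,
      (congrArg f unitInterval.symm_zero).trans h1, (congrArg f unitInterval.symm_one).trans h0⟩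

theorem _root_.singularEdge_zero (τ : C(stdSimplex ℝ (Fin 3), B)) (i j : Fin 3) :
    singularEdge τ i j 0 = τ (stdSimplex.vertex i) := by
  have h : stdSimplexHomeomorphUnitInterval.symm 0 = stdSimplex.vertex (S := ℝ) (0 : Fin 2) := by
    rw [Homeomorph.symm_apply_eq]; rfl
  change τ (stdSimplex.map ![i, j] (stdSimplexHomeomorphUnitInterval.symm 0)) = _
  rw [h, stdSimplex.map_vertex]
  rfl

theorem _root_.singularEdge_one (τ : C(stdSimplex ℝ (Fin 3), B)) (i j : Fin 3) :
    singularEdge τ i j 1 = τ (stdSimplex.vertex j) := by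
  have h : stdSimplexHomeomorphUnitInterval.symm 1 = stdSimplex.vertex (S := ℝ) (1 : Fin 2) := by
    rw [Homeomorph.symm_apply_eq]; rfl
  change τ (stdSimplex.map ![i, j] (stdSimplexHomeomorphUnitInterval.symm 1)) = _
  rw [h, stdSimplex.map_vertex]
  rfl

/-- The holonomy along the boundary of a singular simplex is trivial. -/
theorem holonomy_singularEdge_mul (p : (b : B) → F.Frame b) (τ : C(stdSimplex ℝ (Fin 3), B))
    (i j k : Fin 3) :
    F.holonomy p (singularEdge τ i j) * F.holonomy p (singularEdge τ j k) =
      F.holonomy p (singularEdge τ i k) := by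
  refine Subtype.ext (Equiv.ext fun m => ?_)
  -- One lift of the whole simplex, prescribed at vertex `k`, restricts to lifts of all three edges
  -- and so computes all three holonomies.
  obtain ⟨f, hf, hfτ, hfv⟩ := exists_horizontal_lift_simplex p τ (stdSimplex.vertex k)
    ((p (τ (stdSimplex.vertex k))).proj_toFun m)
  have hface : ∀ (i j : Fin 3) (m : M),
      f (stdSimplex.vertex j) = (p (τ (stdSimplex.vertex j))).toFun m →
      f (stdSimplex.vertex i) = (p (τ (stdSimplex.vertex i))).toFun
        ((F.holonomy p (singularEdge τ i j) : Equiv.Perm M) m) := by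
    intro i j m hm
    let u : C(unitInterval, stdSimplex ℝ (Fin 3)) :=
      singularEdge (ContinuousMap.id (stdSimplex ℝ (Fin 3))) i j
    have := holonomy_apply p (singularEdge τ i j) (singularEdge_zero τ i j)
      (singularEdge_one τ i j) (hf.comp u.continuous) (fun t => hfτ _) (m := m)
      ((congrArg f (singularEdge_one (ContinuousMap.id _) i j)).trans hm)
    rw [← this]
    exact (congrArg f (singularEdge_zero (ContinuousMap.id _) i j)).symm
  have h1 := hface i j _ (hface j k m hfv)
  have h2 := hface i k m hfv
  exact (p (τ (stdSimplex.vertex i))).injective (h1.symm.trans h2)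

end FoliatedSymplecticBundle

end Holonomy

/-! ### Singular coboundaries in low degree. -/

theorem simplexMap_comp {m n k : ℕ} (f : Fin n → Fin k) (g : Fin m → Fin n) :
    (simplexMap f).comp (simplexMap g) = simplexMap (f ∘ g) :=
  ContinuousMap.ext fun s => stdSimplex.map_comp_apply g f s

/-- The twelve double faces cancel in pairs of opposite sign, by the six simplicial identities
below. -/
theorem singularCoboundary_comp_one {B : Type*} [TopologicalSpace B] (c : SingularCochain B 1) :
    singularCoboundary B 2 (singularCoboundary B 1 c) = 0 := by
  funext τ
  have hd : ∀ (i : Fin 4) (j : Fin 3), (τ.comp (simplexMap i.succAbove)).comp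
      (simplexMap j.succAbove) = τ.comp (simplexMap (i.succAbove ∘ j.succAbove)) := fun i j => by
    rw [ContinuousMap.comp_assoc, simplexMap_comp]
  have h01 : (0 : Fin 4).succAbove ∘ (0 : Fin 3).succAbove =
      (1 : Fin 4).succAbove ∘ (0 : Fin 3).succAbove := by decide
  have h02 : (0 : Fin 4).succAbove ∘ (1 : Fin 3).succAbove =
      (2 : Fin 4).succAbove ∘ (0 : Fin 3).succAbove := by decide
  have h03 : (0 : Fin 4).succAbove ∘ (2 : Fin 3).succAbove =
      (3 : Fin 4).succAbove ∘ (0 : Fin 3).succAbove := by decide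
  have h12 : (1 : Fin 4).succAbove ∘ (1 : Fin 3).succAbove =
      (2 : Fin 4).succAbove ∘ (1 : Fin 3).succAbove := by decide
  have h13 : (1 : Fin 4).succAbove ∘ (2 : Fin 3).succAbove =
      (3 : Fin 4).succAbove ∘ (1 : Fin 3).succAbove := by decide
  have h23 : (2 : Fin 4).succAbove ∘ (2 : Fin 3).succAbove =
      (3 : Fin 4).succAbove ∘ (2 : Fin 3).succAbove := by decide
  change ∑ i : Fin 4, (-1 : ℝ) ^ (i : ℕ) * ∑ j : Fin 3, (-1 : ℝ) ^ (j : ℕ) *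
    c ((τ.comp (simplexMap i.succAbove)).comp (simplexMap j.succAbove)) = 0
  simp only [hd, Fin.sum_univ_four, Fin.sum_univ_three]
  rw [h01, h02, h03, h12, h13, h23]
  norm_num
  ring

/-- Holonomy lives on paths, so the cochain that bounds will come from a function of paths; this
converts between the two parametrizations of an edge. -/
theorem singularCoboundary_one_apply {B : Type*} [TopologicalSpace B] (a : C(unitInterval, B) → ℝ)
    (τ : C(stdSimplex ℝ (Fin 3), B)) :
    singularCoboundary B 1 (fun σ => a (σ.comp ⟨stdSimplexHomeomorphUnitInterval.symm,
      stdSimplexHomeomorphUnitInterval.symm.continuous⟩)) τ =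
      a (singularEdge τ 0 1) + a (singularEdge τ 1 2) - a (singularEdge τ 0 2) := by
  have h0 : (0 : Fin 3).succAbove = ![1, 2] := by decide
  have h1 : (1 : Fin 3).succAbove = ![0, 2] := by decide
  have h2 : (2 : Fin 3).succAbove = ![0, 1] := by decide
  change ∑ i : Fin 3, (-1 : ℝ) ^ (i : ℕ) * a ((τ.comp (simplexMap i.succAbove)).comp _) = _
  rw [Fin.sum_univ_three, h0, h1, h2]
  unfold singularEdge
  norm_num
  ring

/-! ### Exact isotropic submanifolds and the bounding cochain. -/

section Isotropic

variable {V : Type*} [NormedAddCommGroup V] [NormedSpace ℝ V]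
  {M : Type*} [TopologicalSpace M] [ChartedSpace V M]
  {W : Type*} [NormedAddCommGroup W] [NormedSpace ℝ W]
  {L : Type*} [TopologicalSpace L] [ChartedSpace W L]
  {lam : OneForm V M}

/-- If `g` maps the image of `j₁` to that of `j₀`, then the restriction of a primitive of
`g^*λ - λ` is determined up to a constant by primitives of `j₀^*λ` and `j₁^*λ`. -/
theorem Symp.exists_primitive_restrict [IsManifold 𝓘(ℝ, W) ∞ L] [ConnectedSpace L] (g : Symp lam) {j₀ j₁ : L → M}
    (hj₀ : ContMDiff 𝓘(ℝ, W) 𝓘(ℝ, V) ∞ j₀) (hj₁ : ContMDiff 𝓘(ℝ, W) 𝓘(ℝ, V) ∞ j₁) {u : L → L}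
    (hu : ContMDiff 𝓘(ℝ, W) 𝓘(ℝ, W) ∞ u) (hgu : (g : Equiv.Perm M) ∘ j₁ = j₀ ∘ u)
    {φ₀ φ₁ : L → ℝ} (hφ₀ : (lam.pullback j₀ : OneForm W L).HasPrimitive φ₀)
    (hφ₁ : (lam.pullback j₁ : OneForm W L).HasPrimitive φ₁) {f : M → ℝ}
    (hf : (lam.pullback (g : Equiv.Perm M) - lam : OneForm V M).HasPrimitive f) :
    ∃ a : ℝ, ∀ l, f (j₁ l) = a + φ₀ (u l) - φ₁ l := by
  have h1 := hf.pullback hj₁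
  have h2 := (hφ₀.pullback hu).sub hφ₁
  -- Both functions are now primitives of `(j₀ ∘ u)^*λ - j₁^*λ` on the connected `L`.
  rw [OneForm.pullback_sub, ← OneForm.pullback_comp lam (Symp.contMDiff g) hj₁, hgu,
    OneForm.pullback_comp lam hj₀ hu] at h1
  let l₀ : L := Classical.arbitrary L
  refine ⟨f (j₁ l₀) - φ₀ (u l₀) + φ₁ l₀, fun l => ?_⟩
  have := h1.sub_eq_sub h2 l₀ l
  simp only [Function.comp_apply, Pi.sub_apply] at this
  linarith

/-- `(k ∘ j)^*λ = j^*(k^*λ - λ) + j^*λ`, so exact isotropy survives moving `L` by `k` once `k^*λ -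
λ` is exact. -/
theorem OneForm.HasPrimitive.pullback_symp_inv {k : Symp lam} {j : L → M}
    (hj : ContMDiff 𝓘(ℝ, W) 𝓘(ℝ, V) ∞ j) {φ : L → ℝ} {f : M → ℝ}
    (hφ : (lam.pullback j : OneForm W L).HasPrimitive φ)
    (hf : (lam.pullback (k : Equiv.Perm M) - lam : OneForm V M).HasPrimitive f) :
    (lam.pullback ((k : Equiv.Perm M) ∘ j) : OneForm W L).HasPrimitive (f ∘ j + φ) := by
  have h := (hf.pullback hj).add hφ
  rwa [OneForm.pullback_sub, ← OneForm.pullback_comp lam (Symp.contMDiff k) hj,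
    sub_add_cancel] at h

/-- A diffeomorphism that preserves an embedded submanifold restricts to a smooth map. -/
theorem exists_contMDiff_restrict [IsManifold 𝓘(ℝ, V) ∞ M] {i : L → M}
    (hi : Manifold.IsSmoothEmbedding 𝓘(ℝ, W) 𝓘(ℝ, V) ∞ i) {G : M → M}
    (hG : ContMDiff 𝓘(ℝ, V) 𝓘(ℝ, V) ∞ G) (h : ∀ l, G (i l) ∈ range i) :
    ∃ u : L → L, ContMDiff 𝓘(ℝ, W) 𝓘(ℝ, W) ∞ u ∧ G ∘ i = i ∘ u := by
  choose u hu using h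
  have hc : i ∘ u = G ∘ i := funext hu
  have hs : ContMDiff 𝓘(ℝ, W) 𝓘(ℝ, V) ∞ (i ∘ u) := by
    rw [hc]
    exact hG.comp hi.contMDiff
  -- The topological embedding gives continuity of `u`; the immersion then gives smoothness.
  exact ⟨u, (ContMDiff.iff_comp_isImmersion hi.isImmersion).2
    ⟨hi.isEmbedding.continuous_iff.2 hs.continuous, hs⟩, hc.symm⟩

namespace FoliatedSymplecticBundle

variable {B E : Type*} [TopologicalSpace B] [TopologicalSpace E]
  {F : FoliatedSymplecticBundle lam B E}

/-- The trivialization adapted to `E'` need not be flat, but on one fibre both it and the frame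
differ from a foliated chart by symplectic maps; `k` is the quotient of these. -/
theorem IsFoliatedSubbundle.exists_symp {S : Set M} {E' : Set E}
    (hE' : F.IsFoliatedSubbundle S E') {b : B} (p : F.Frame b) :
    ∃ k : Symp lam, ∀ m, p.toFun m ∈ E' ↔ (k : Equiv.Perm M) m ∈ S := by
  obtain ⟨t, ht, hbt, htE⟩ := hE'.locallyTrivial b
  obtain ⟨e, he, hbe⟩ := F.exists_mem_baseSet b
  obtain ⟨g, hg⟩ := p.symplectic e he hbe
  obtain ⟨g', hg'⟩ := ht b hbt e he hbe
  refine ⟨g'⁻¹ * g, fun m => ?_⟩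
  rw [htE _ (by rwa [p.proj_toFun])]
  have h : (t (p.toFun m)).2 = ((g'⁻¹ * g : Symp lam) : Equiv.Perm M) m := by
    refine (g' : Equiv.Perm M).injective ?_
    rw [← hg' _ (p.proj_toFun m), hg]
    simp
  rw [h]

/-- The characteristic cochain of a bundle with an exact isotropic foliated subbundle is a
coboundary. -/
theorem IsFoliatedSubbundle.exists_coboundary_eq [IsManifold 𝓘(ℝ, V) ∞ M] [ConnectedSpace M]
    [IsManifold 𝓘(ℝ, W) ∞ L] [ConnectedSpace L] (hlam : lam.IsSmooth) (hM : FirstDeRhamVanishes V M) {i : L → M}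
    (hi : Manifold.IsSmoothEmbedding 𝓘(ℝ, W) 𝓘(ℝ, V) ∞ i)
    (hL : OneForm.IsExact (lam.pullback i : OneForm W L)) {E' : Set E}
    (hE' : F.IsFoliatedSubbundle (range i) E') (x : M) (p : (b : B) → F.Frame b) :
    ∃ c : SingularCochain B 1, singularCoboundary B 1 c = F.charCochain x p := by
  choose f hf hfx using Symp.exists_primitive hlam hM x
  obtain ⟨φ, hφ⟩ := hL
  choose k hk using fun b => hE'.exists_symp (p b)
  let j : B → L → M := fun b => ((k b)⁻¹ : Symp lam) ∘ i
  have hj : ∀ b, ContMDiff 𝓘(ℝ, W) 𝓘(ℝ, V) ∞ (j b) := fun b =>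
    (Symp.contMDiff (k b)⁻¹).comp hi.contMDiff
  have hjk : ∀ b l, (k b : Equiv.Perm M) (j b l) = i l := fun b l =>
    (k b : Equiv.Perm M).apply_symm_apply (i l)
  have hkj : ∀ b m l, (k b : Equiv.Perm M) m = i l → m = j b l := fun b m l h =>
    (k b : Equiv.Perm M).injective (h.trans (hjk b l).symm)
  have hji : ∀ b, Function.Injective (j b) := fun b =>
    ((k b)⁻¹ : Symp lam).1.injective.comp hi.isEmbedding.injective
  let ψ : B → L → ℝ := fun b => f (k b)⁻¹ ∘ i + φ
  have hψ : ∀ b, (lam.pullback (j b) : OneForm W L).HasPrimitive (ψ b) := fun b =>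
    OneForm.HasPrimitive.pullback_symp_inv hi.contMDiff hφ (hf _)
  have key : ∀ γ : C(unitInterval, B), ∃ (u : L → L) (a : ℝ),
      (∀ l, (F.holonomy p γ : Equiv.Perm M) (j (γ 1) l) = j (γ 0) (u l)) ∧
      ∀ l, f (F.holonomy p γ) (j (γ 1) l) = a + ψ (γ 0) (u l) - ψ (γ 1) l := by
    intro γ
    -- Conjugated by the corrections `k`, the holonomy maps the fixed copy `range i` into itself.
    obtain ⟨u, hu, hiu⟩ := exists_contMDiff_restrict hi
      (Symp.contMDiff (k (γ 0) * F.holonomy p γ * (k (γ 1))⁻¹)) (fun l => by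
        refine (hk (γ 0) _).1 ((holonomy_mem_iff p γ hE'.leaf_subset (j (γ 1) l)).2 ?_)
        rw [hk, hjk]
        exact mem_range_self l)
    have hgu : ∀ l, (F.holonomy p γ : Equiv.Perm M) (j (γ 1) l) = j (γ 0) (u l) := fun l =>
      hkj _ _ _ (congrFun hiu l)
    obtain ⟨a, ha⟩ := Symp.exists_primitive_restrict (F.holonomy p γ) (hj (γ 0)) (hj (γ 1)) hu
      (funext hgu) (hψ _) (hψ _) (hf _)
    exact ⟨u, a, hgu, ha⟩
  choose u a hu ha using key
  refine ⟨fun σ => a (σ.comp ⟨stdSimplexHomeomorphUnitInterval.symm,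
    stdSimplexHomeomorphUnitInterval.symm.continuous⟩), funext fun τ => ?_⟩
  rw [singularCoboundary_one_apply]
  let l : L := Classical.arbitrary L
  have hmul := holonomy_singularEdge_mul p τ 0 1 2
  have hu₀₁ := hu (singularEdge τ 0 1)
  have hu₁₂ := hu (singularEdge τ 1 2)
  have hu₀₂ := hu (singularEdge τ 0 2)
  have ha₀₁ := ha (singularEdge τ 0 1)
  have ha₁₂ := ha (singularEdge τ 1 2)
  have ha₀₂ := ha (singularEdge τ 0 2)
  simp only [singularEdge_zero, singularEdge_one] at hu₀₁ hu₁₂ hu₀₂ ha₀₁ ha₁₂ ha₀₂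
  -- Multiplicativity of holonomy descends to the maps `u` because `j` is injective.
  have huu : u (singularEdge τ 0 2) l = u (singularEdge τ 0 1) (u (singularEdge τ 1 2) l) := by
    apply hji (τ (stdSimplex.vertex 0))
    rw [← hu₀₂, ← hu₀₁, ← hu₁₂, ← hmul]
    rfl
  -- The free point is taken on the copy of `L` over the last vertex; the reference point `x` need
  -- not lie on any copy.
  have hG := sympCocycle_eq (hf (F.holonomy p (singularEdge τ 0 1)))
    (hf (F.holonomy p (singularEdge τ 1 2))) (hf _) (hfx _) (hfx _) (hfx _)
    (j (τ (stdSimplex.vertex 2)) l)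
  rw [hmul, hu₁₂, ha₀₁, ha₁₂, ha₀₂, huu] at hG
  unfold charCochain
  rw [hG]
  ring

end FoliatedSymplecticBundle

end Isotropic

theorem corollary5p1
    -- the connected exact symplectic manifold `(M, dλ)` with `H¹(M; ℝ) = 0`
    {V : Type*} [NormedAddCommGroup V] [NormedSpace ℝ V] [FiniteDimensional ℝ V]
    {M : Type*} [TopologicalSpace M] [ChartedSpace V M] [IsManifold 𝓘(ℝ, V) ∞ M]
    [T2Space M] [SecondCountableTopology M] [ConnectedSpace M]
    (lam : OneForm V M) (hlam : IsExactSymplectic lam) (hM : FirstDeRhamVanishes V M)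
    -- the connected exact isotropic submanifold `i : L → M`
    {W : Type*} [NormedAddCommGroup W] [NormedSpace ℝ W] [FiniteDimensional ℝ W]
    {L : Type*} [TopologicalSpace L] [ChartedSpace W L] [IsManifold 𝓘(ℝ, W) ∞ L]
    [ConnectedSpace L]
    (i : L → M) (hi : Manifold.IsSmoothEmbedding 𝓘(ℝ, W) 𝓘(ℝ, V) ∞ i)
    (hL : OneForm.IsExact (lam.pullback i : OneForm W L))
    -- the foliated symplectic bundle `(M, dλ) → E → B` and its foliated subbundle `L → E' → B`
    {B : Type*} [TopologicalSpace B] {E : Type*} [TopologicalSpace E]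
    (F : FoliatedSymplecticBundle lam B E)
    (E' : Set E) (hE' : F.IsFoliatedSubbundle (Set.range i) E')
    -- the choices made in the construction of the class: a reference point of `M` and
    -- symplectic identifications of `M` with the fibres of `E`
    (x : M) (p : (b : B) → F.Frame b) :
    ∃ hc : F.charCochain x p ∈ SingularZ2 B,
      (Submodule.Quotient.mk ⟨F.charCochain x p, hc⟩ : SingularH2 B) = 0 := by

  obtain ⟨c, hc⟩ := hE'.exists_coboundary_eq hlam.smooth hM hi hL x p
  refine ⟨?_, ?_⟩
  -- A coboundary is a cocycle, so the group cocycle identity is not needed.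
  · rw [LinearMap.mem_ker, ← hc, singularCoboundary_comp_one]
  · rw [Submodule.Quotient.mk_eq_zero]
    exact ⟨c, hc⟩
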